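/- Let $\mathfrak{g}$ be a finite-dimensional complex semisimple Lie algebra with a Cartan subalgebra and a basis of simple roots $\alpha_1,\dots,\alpha_\ell$ of its root system. Let $h_i,x_i,y_i\in\mathfrak{g}$ ($1\le i\le \ell$) be canonical generators, that is, nonzero elements with $$[h_i,h_j]=0,\quad [h_i,x_j]=\langle\alpha_j,\alpha_i^\vee\rangle x_j,\quad [h_i,y_j]=-\langle\alpha_j,\alpha_i^\vee\rangle y_j,\quad [x_i,y_j]=\delta_{ij}h_i,$$ and let $\mathfrak{h}$ be the span of the $h_i$. For a representation of $\mathfrak{g}$ and $\lambda\in\mathfrak{h}^*$, a highest weight vector of weight $\lambda$ is a vector on which every $h\in\mathfrak{h}$ acts as the scalar $\lambda(h)$ and which is annihilated by all $x_i$; $\lambda$ is a highest weight if a nonzero such vector exists. Let $\rho:\mathfrak{g}\to\mathfrak{gl}(V)$ and $\varphi:\mathfrak{g}\to\mathfrak{gl}(W)$ be finite-dimensional irreducible complex representations with the same highest weight $\lambda$, and let $v_\lambda\in V$, $w_\lambda\in W$ be nonzero highest weight vectors of weight $\lambda$. Let $S_\lambda$ be a set of finite sequences $(i_1,\dots,i_k)$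 with $k\ge 0$ and $1\le i_r\le\ell$, such that the vectors $\rho(y_{i_1})\cdots\rho(y_{i_k})v_\lambda$, indexed by the sequences $(i_1,\dots,i_k)\in S_\lambda$, form a basis of $V$. Let $A:V\to W$ be the linear map with $$A\bigl(\rho(y_{i_1})\cdots\rho(y_{i_k})v_\lambda\bigr)=\varphi(y_{i_1})\cdots\varphi(y_{i_k})w_\lambda\qquad\text{for all }(i_1,\dots,i_k)\in S_\lambda.$$ Then $A\rho(z)=\varphi(z)A$ for all $z\in\mathfrak{g}$. -/

import Mathlib

namespace HighestWeight

open LieAlgebra.IsKilling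

section Generators

variable {L : Type*} [LieRing L] [LieAlgebra ℂ L] [FiniteDimensional ℂ L]
  [LieAlgebra.IsSemisimple ℂ L] {H : LieSubalgebra ℂ L} [H.IsCartanSubalgebra]

/-- `g`, `x`, `y` form a canonical generating set of the complex semisimple Lie algebra `L`
(with respect to the base `b` of simple roots of the root system of `(L, H)`): nonzero elements
indexed by the simple roots and satisfying
`[g_i, g_j] = 0`, `[g_i, x_j] = ⟨α_j, α_i^∨⟩ x_j`, `[g_i, y_j] = -⟨α_j, α_i^∨⟩ y_j`,
`[x_i, y_j] = δ_ij g_i`.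
The elements need not lie in `H` or in its root spaces. If `x_i` is nonzero then so are
`g_i` and `y_i`. Here `(rootSystem H).pairing j i` is `⟨α_j, α_i^∨⟩ = α_j (α_i^∨)`. -/
structure IsCanonicalGeneratingSet (b : (rootSystem H).Base) (g x y : b.support → L) : Prop where
  lie_g_g : ∀ i j, ⁅g i, g j⁆ = 0
  lie_g_x : ∀ i j, ⁅g i, x j⁆ = (rootSystem H).pairing j i • x j
  lie_g_y : ∀ i j, ⁅g i, y j⁆ = -((rootSystem H).pairing j i • y j)
  lie_x_y_same : ∀ i, ⁅x i, y i⁆ = g i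
  lie_x_y_ne : ∀ i j, i ≠ j → ⁅x i, y j⁆ = 0
  x_ne_zero : ∀ i, x i ≠ 0

end Generators

section Modules

variable {ι L V W : Type*} [LieRing L] [LieAlgebra ℂ L]
  [AddCommGroup V] [Module ℂ V] [LieRingModule L V] [LieModule ℂ L V]
  [AddCommGroup W] [Module ℂ W] [LieRingModule L W] [LieModule ℂ L W]

/-- `v` is a nonzero highest weight vector of weight `lam`, where `lam` is a linear form on the span
of the `g_i`: `ρ(h) v = lam(h) v` for all `h` in that span, and `ρ(x_i) v = 0` for all `i`. -/
structure IsHighestWeightVector (g x : ι → L)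
    (lam : Module.Dual ℂ (Submodule.span ℂ (Set.range g))) (v : V) : Prop where
  ne_zero : v ≠ 0
  weight : ∀ h : Submodule.span ℂ (Set.range g), LieModule.toEnd ℂ L V (h : L) v = lam h • v
  killed : ∀ i, LieModule.toEnd ℂ L V (x i) v = 0

/-- The vector `ρ(y_{i_1}) ⋯ ρ(y_{i_k}) v` for the sequence `(i_1, …, i_k)`. -/
def word (y : ι → L) (v : V) (s : List ι) : V :=
  (s.map fun i => LieModule.toEnd ℂ L V (y i)).prod v

/-- The vectors `ρ(y_{i_1}) ⋯ ρ(y_{i_k}) v`, for `(i_1, …, i_k) ∈ S`, form a basis of `V`. -/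
structure IsWordBasis (y : ι → L) (v : V) (S : Set (List ι)) : Prop where
  linearIndependent : LinearIndependent ℂ fun s : S => word y v (s : List ι)
  span_eq_top : ⊤ ≤ Submodule.span ℂ (Set.range fun s : S => word y v (s : List ι))

/-- The linear map `A : V → W` with
`A (ρ(y_{i_1}) ⋯ ρ(y_{i_k}) v) = φ(y_{i_1}) ⋯ φ(y_{i_k}) w` for all `(i_1, …, i_k) ∈ S`. -/
noncomputable def wordMap {y : ι → L} {v : V} {S : Set (List ι)} (hS : IsWordBasis y v S) (w : W) :
    V →ₗ[ℂ] W :=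
  (Module.Basis.mk hS.linearIndependent hS.span_eq_top).constr ℂ
    fun s : S => word y w (s : List ι)

theorem wordMap_word {y : ι → L} {v : V} {S : Set (List ι)} (hS : IsWordBasis y v S) (w : W)
    {s : List ι} (hs : s ∈ S) : wordMap hS w (word y v s) = word y w s := by
  have h := (Module.Basis.mk hS.linearIndependent hS.span_eq_top).constr_basis ℂ
    (fun s : S => word y w (s : List ι)) ⟨s, hs⟩
  rwa [Module.Basis.mk_apply] at h

end Modules

end HighestWeight

/-! Let `U` in `V × W` be the span of all pairs (word in `v`, the same word in `w`), `wordPairSpan`.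
Since `v` and `w` have the same weight, moving `x i` through a word produces the same coefficients
on both sides. So `U` is stable under every `x i` and `y i`, hence under `L` once these generate
`L`. The `w'` with `(0, w') ∈ U` form a submodule of `W`. It misses `w`, because `(v, w)` is the
only spanning pair of top degree, so by irreducibility it is zero. Now `U` contains the graph of
`A`, and its stability puts `(0, A ρ(z) u - φ(z) A u)` in `U`, so the second entry vanishes.

Generation (`generated_eq_top`) needs proof, since the generators are given by relations only and
may lie outside `H` and its root spaces. By sl2 theory the weights of the generated subalgebra under
the `g i` are stable under simple reflections, so every root occurs. Together with the independent
`g i` this already accounts for `dim L`. -/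

section

open LieAlgebra LieAlgebra.IsKilling LieModule Module

/-! ### Weight reflection for sl2-triples -/

namespace IsSl2Triple

variable {K L M : Type*} [Field K] [CharZero K] [LieRing L] [LieAlgebra K L]
  [AddCommGroup M] [Module K M] [LieRingModule L M] [LieModule K L M]
  {h e f : L} {m : M} {μ : K}

variable [FiniteDimensional K M]

theorem exists_pow_toEnd_e_eq_zero (t : IsSl2Triple h e f) (hm : ⁅h, m⁆ = μ • m) :
    ∃ n : ℕ, (toEnd K L M e ^ n) m = 0 := by
  by_contra! contra
  -- Otherwise the vectors `e ^ n m` would have infinitely many distinct eigenvalues `μ + 2n`.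
  have hli := (toEnd K L M h).eigenvectors_linearIndependent' (fun n : ℕ ↦ μ + 2 * n)
    (fun a b hab ↦ by simpa using hab) (fun n ↦ (toEnd K L M e ^ n) m)
    (fun n ↦ Module.End.hasEigenvector_iff.mpr
      ⟨Module.End.mem_eigenspace_iff.mpr (t.lie_h_pow_toEnd_e hm n), contra n⟩)
  have := hli.finite_of_isNoetherian
  exact not_finite ℕ

/-- A nonzero vector of weight `n ≥ 0` yields a nonzero vector of weight `-n`. -/
theorem exists_pow_toEnd_f_pow_toEnd_e_ne_zero (t : IsSl2Triple h e f) (hm₀ : m ≠ 0) {n : ℕ}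
    (hm : ⁅h, m⁆ = (n : K) • m) :
    ∃ k : ℕ, (toEnd K L M f ^ (n + k)) ((toEnd K L M e ^ k) m) ≠ 0 := by
  -- For the last `k` with `e ^ k m ≠ 0`, this vector is primitive of weight `n + 2k`, so `n + k ≤ n
  -- + 2k` lowerings do not kill it.
  obtain ⟨k, hk, hk'⟩ := Nat.exists_not_and_succ_of_not_zero_of_exists
    (p := fun k ↦ (toEnd K L M e ^ k) m = 0) (by simpa using hm₀)
    (t.exists_pow_toEnd_e_eq_zero hm)
  have P : t.HasPrimitiveVectorWith ((toEnd K L M e ^ k) m) ((n : K) + 2 * k) :=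
    { ne_zero := hk
      lie_h := t.lie_h_pow_toEnd_e hm k
      lie_e := by rwa [pow_succ', Module.End.mul_apply, toEnd_apply_apply] at hk' }
  exact ⟨k, P.pow_toEnd_f_ne_zero_of_eq_nat (n := n + 2 * k) (by push_cast; rfl) (by lia)⟩

end IsSl2Triple

namespace HighestWeight

/-- The simultaneous eigenspace of the operators `g i` with eigenvalues `χ i`. -/
def jointEigenspace {K L M ι : Type*} [CommRing K] [LieRing L] [LieAlgebra K L]
    [AddCommGroup M] [Module K M] [LieRingModule L M] [LieModule K L M] (g : ι → L) (χ : ι → K) :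
    Submodule K M :=
  ⨅ i, (toEnd K L M (g i)).eigenspace (χ i)

/-! ### Joint eigenspaces of commuting elements -/

section JointEigenspace

variable {K L M ι : Type*} [Field K] [LieRing L] [LieAlgebra K L]
    [AddCommGroup M] [Module K M] [LieRingModule L M] [LieModule K L M] {g : ι → L} {χ : ι → K}

theorem mem_jointEigenspace {m : M} : m ∈ jointEigenspace g χ ↔ ∀ i, ⁅g i, m⁆ = χ i • m := by
  simp [jointEigenspace]

theorem iSupIndep_jointEigenspace (hg : ∀ i j, ⁅g i, g j⁆ = 0) :
    iSupIndep fun χ : ι → K ↦ (jointEigenspace g χ : Submodule K M) := by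
  have hind : iSupIndep fun χ : ι → K ↦ ⨅ i, (toEnd K L M (g i)).maxGenEigenspace (χ i) := by
    refine Module.End.independent_iInf_maxGenEigenspace_of_forall_mapsTo
      (fun i ↦ toEnd K L M (g i)) fun i j φ ↦ Module.End.mapsTo_maxGenEigenspace_of_comm ?_ φ
    exact LinearMap.ext fun m ↦ by
      simp only [Module.End.mul_apply, toEnd_apply_apply]
      rw [leibniz_lie, hg, zero_lie, zero_add]
  exact hind.mono fun χ ↦ iInf_mono fun i ↦
    ((toEnd K L M (g i)).genEigenspace (χ i)).mono le_top

theorem pow_toEnd_mem_jointEigenspace {z : L} {a : ι → K} (hz : ∀ i, ⁅g i, z⁆ = a i • z) {m : M}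
    (hm : m ∈ jointEigenspace g χ) (n : ℕ) :
    (toEnd K L M z ^ n) m ∈ jointEigenspace g (χ + (n : K) • a) := by
  rw [mem_jointEigenspace] at *
  intro i
  induction n with
  | zero => simpa using hm i
  | succ n ih =>
    rw [pow_succ', Module.End.mul_apply, toEnd_apply_apply, leibniz_lie, hz, ih,
      lie_smul, smul_lie, ← add_smul]
    congr 1
    simp only [Pi.add_apply, Pi.smul_apply, smul_eq_mul]
    push_cast
    ring

end JointEigenspace

/-! ### Canonical generators generate the Lie algebra -/

section Generators

variable {L : Type*} [LieRing L] [LieAlgebra ℂ L] [FiniteDimensional ℂ L]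
  [LieAlgebra.IsSemisimple ℂ L] {H : LieSubalgebra ℂ L} [H.IsCartanSubalgebra]
  {b : (rootSystem H).Base} {g x y : b.support → L}

namespace IsCanonicalGeneratingSet

theorem isSl2Triple (hgen : IsCanonicalGeneratingSet b g x y) (i : b.support) :
    IsSl2Triple (g i) (x i) (y i) where
  h_ne_zero h := by
    have := hgen.lie_g_x i i
    rw [h, zero_lie, RootPairing.pairing_same, eq_comm, smul_eq_zero] at this
    exact this.elim two_ne_zero (hgen.x_ne_zero i)
  lie_e_f := hgen.lie_x_y_same i
  lie_h_e_nsmul := by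
    rw [hgen.lie_g_x, RootPairing.pairing_same, two_smul, two_smul]
  lie_h_f_nsmul := by
    rw [hgen.lie_g_y, RootPairing.pairing_same, two_smul, two_smul]

/-- The subalgebra generated by the `x i` and the `y i`. -/
def generated (x y : b.support → L) : LieSubalgebra ℂ L :=
  LieSubalgebra.lieSpan ℂ L (Set.range x ∪ Set.range y)

theorem x_mem_generated (i : b.support) : x i ∈ generated x y :=
  LieSubalgebra.subset_lieSpan (Or.inl ⟨i, rfl⟩)

theorem y_mem_generated (i : b.support) : y i ∈ generated x y :=
  LieSubalgebra.subset_lieSpan (Or.inr ⟨i, rfl⟩)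

theorem g_mem_generated (hgen : IsCanonicalGeneratingSet b g x y) (i : b.support) :
    g i ∈ generated x y :=
  hgen.lie_x_y_same i ▸
    LieSubalgebra.lie_mem _ (x_mem_generated i) (y_mem_generated i)

theorem pow_toEnd_mem_generated {z m : L} (hz : z ∈ generated x y) (hm : m ∈ generated x y)
    (n : ℕ) : (toEnd ℂ L L z ^ n) m ∈ generated x y := by
  induction n with
  | zero => simpa using hm
  | succ n ih =>
    rw [pow_succ', Module.End.mul_apply, toEnd_apply_apply]
    exact LieSubalgebra.lie_mem _ hz ih

/-- The generated subalgebra has a nonzero vector of weight `χ`. -/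
def IsGeneratedWeight (g x y : b.support → L) (χ : b.support → ℂ) : Prop :=
  ∃ z ∈ generated x y, z ≠ 0 ∧ z ∈ jointEigenspace (M := L) g χ

/-- Raising `k` times and lowering `n + k` times shifts the weight by exactly `-n` copies of the
simple root; for negative `n`, `x j` and `y j` exchange roles. -/
theorem IsGeneratedWeight.reflect (hgen : IsCanonicalGeneratingSet b g x y)
    {χ : b.support → ℂ} (hχ : IsGeneratedWeight g x y χ) (j : b.support) {n : ℤ} (hn : χ j = n) :
    IsGeneratedWeight g x y (χ - (n : ℂ) • fun i : b.support ↦ (rootSystem H).pairing j i) := by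
  obtain ⟨z, hz, hz₀, hzχ⟩ := hχ
  have hzj := mem_jointEigenspace.mp hzχ j
  have hx := fun i ↦ hgen.lie_g_x i j
  have hy : ∀ i, ⁅g i, y j⁆ = (-fun i : b.support ↦ (rootSystem H).pairing j i) i • y j := by
    intro i
    rw [hgen.lie_g_y, Pi.neg_apply, neg_smul]
  obtain ⟨n, rfl | rfl⟩ := n.eq_nat_or_neg
  · obtain ⟨k, hk⟩ := (hgen.isSl2Triple j).exists_pow_toEnd_f_pow_toEnd_e_ne_zero (K := ℂ)
      (n := n) hz₀ (by simpa [hn] using hzj)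
    refine ⟨_, pow_toEnd_mem_generated (y_mem_generated j)
      (pow_toEnd_mem_generated (x_mem_generated j) hz k) _, hk, ?_⟩
    convert pow_toEnd_mem_jointEigenspace hy (pow_toEnd_mem_jointEigenspace hx hzχ k) (n + k) using 1
    congr 1
    push_cast
    module
  · obtain ⟨k, hk⟩ := (hgen.isSl2Triple j).symm.exists_pow_toEnd_f_pow_toEnd_e_ne_zero (K := ℂ)
      (n := n) hz₀ (by rw [neg_lie, hzj, hn]; simp)
    refine ⟨_, pow_toEnd_mem_generated (x_mem_generated j)
      (pow_toEnd_mem_generated (y_mem_generated j) hz k) _, hk, ?_⟩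
    convert pow_toEnd_mem_jointEigenspace hx (pow_toEnd_mem_jointEigenspace hy hzχ k) (n + k) using 1
    congr 1
    push_cast
    module

theorem pairing_reflectionPerm_apply (i β : H.root) :
    (fun k : b.support ↦ (rootSystem H).pairing ((rootSystem H).reflectionPerm i β) k) =
      (fun k : b.support ↦ (rootSystem H).pairing β k) -
        (rootSystem H).pairing β i • fun k : b.support ↦ (rootSystem H).pairing i k := by
  ext k
  have := congrArg ((rootSystem H).coroot' k) ((rootSystem H).root_reflectionPerm i β)
  rwa [RootPairing.reflection_apply, map_sub, map_smul, RootPairing.root_coroot'_eq_pairing,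
    RootPairing.root_coroot'_eq_pairing, RootPairing.root_coroot'_eq_pairing,
    RootPairing.root_coroot'_eq_pairing] at this

theorem isGeneratedWeight_root (hgen : IsCanonicalGeneratingSet b g x y) (β : H.root) :
    IsGeneratedWeight g x y fun k ↦ (rootSystem H).pairing β k := by
  -- The induction on roots has a case of negation, hence both signs are carried along.
  suffices IsGeneratedWeight g x y (fun k ↦ (rootSystem H).pairing β k) ∧
      IsGeneratedWeight g x y (-fun k : b.support ↦ (rootSystem H).pairing β k) from this.1
  refine b.induction_reflect β
    (p := fun β ↦ IsGeneratedWeight g x y (fun k ↦ (rootSystem H).pairing β k) ∧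
      IsGeneratedWeight g x y (-fun k : b.support ↦ (rootSystem H).pairing β k))
    (fun i hi ↦ ?_) (fun i hi ↦ ?_) (fun i j hi hj ↦ ?_)
  · have : (fun k : b.support ↦ (rootSystem H).pairing ((rootSystem H).reflectionPerm i i) k) =
        -fun k : b.support ↦ (rootSystem H).pairing i k := by
      rw [pairing_reflectionPerm_apply, RootPairing.pairing_same]
      module
    rw [this, neg_neg]
    exact hi.symm
  · refine ⟨⟨x ⟨i, hi⟩, x_mem_generated _, hgen.x_ne_zero _,
      mem_jointEigenspace.mpr fun k ↦ hgen.lie_g_x k _⟩, ⟨y ⟨i, hi⟩, y_mem_generated _,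
      (hgen.isSl2Triple _).f_ne_zero, mem_jointEigenspace.mpr fun k ↦ ?_⟩⟩
    rw [hgen.lie_g_y, Pi.neg_apply, neg_smul]
  · obtain ⟨n, hn⟩ := (rootSystem H).exists_value (S := ℤ) i j
    have hn' : (rootSystem H).pairing i j = n := by simpa using hn.symm
    rw [pairing_reflectionPerm_apply, hn']
    refine ⟨hi.1.reflect hgen ⟨j, hj⟩ hn', ?_⟩
    convert hi.2.reflect hgen ⟨j, hj⟩ (n := -n) (by rw [Pi.neg_apply, hn', Int.cast_neg]) using 1
    push_cast
    module

/-- Root spaces are lines, and `H`, the zero root space, is spanned by the simple coroots. -/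
theorem finrank_le_card_root_add_card_support : finrank ℂ L ≤ Fintype.card (H.root ⊕ b.support) := by
  have hroot (β : H.root) : ∃ e : L, ∀ z ∈ rootSpace H β.1, ∃ c : ℂ, c • e = z := by
    obtain ⟨e, -, he⟩ := finrank_eq_one_iff'.mp
      (finrank_rootSpace_eq_one β.1 (Finset.mem_filter.mp β.2).2)
    refine ⟨e, fun z hz ↦ ?_⟩
    obtain ⟨c, hc⟩ := he ⟨z, hz⟩
    exact ⟨c, congrArg Subtype.val hc⟩
  choose e he using hroot
  let v : H.root ⊕ b.support → L := Sum.elim e fun i ↦ ((rootSystem H).coroot i : L)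
  refine finrank_le_of_span_eq_top (v := v) ?_
  have hH : ∀ h : H, (h : L) ∈ Submodule.span ℂ (Set.range v) := by
    intro h
    rw [← b.toCoweightBasis.sum_repr h, ← LieSubalgebra.coe_incl, map_sum]
    refine Submodule.sum_mem _ fun i _ ↦ ?_
    rw [map_smul, b.toCoweightBasis_apply]
    exact Submodule.smul_mem _ _ (Submodule.subset_span ⟨Sum.inr i, rfl⟩)
  have htop := congrArg LieSubmodule.toSubmodule (iSup_genWeightSpace_eq_top' ℂ H L)
  rw [LieSubmodule.iSup_toSubmodule, LieSubmodule.top_toSubmodule] at htop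
  rw [eq_top_iff, ← htop, iSup_le_iff]
  intro χ z hz
  by_cases hχ : χ.IsZero
  · rw [hχ.eq, LieSubmodule.mem_toSubmodule] at hz
    have hz' : z ∈ H.toLieSubmodule := (rootSpace_zero_eq ℂ L H).le hz
    exact hH ⟨z, hz'⟩
  · obtain ⟨c, rfl⟩ := he ⟨χ, by simpa using hχ⟩ z hz
    exact Submodule.smul_mem _ _ (Submodule.subset_span ⟨Sum.inl _, rfl⟩)

theorem eq_zero_of_apply_coroot_eq_zero {f : Dual ℂ H} (hf : ∀ i : b.support, f ((rootSystem H).coroot i) = 0) :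
    f = 0 :=
  b.toCoweightBasis.ext fun i ↦ by simpa using hf i

theorem linearIndependent_g (hgen : IsCanonicalGeneratingSet b g x y) :
    LinearIndependent ℂ g := by
  rw [Fintype.linearIndependent_iff]
  intro c hc
  have key : ∀ j : b.support, ∑ i, c i * (rootSystem H).pairing j i = 0 := by
    intro j
    have : ⁅∑ i, c i • g i, x j⁆ = 0 := by rw [hc, zero_lie]
    simp only [sum_lie, smul_lie, hgen.lie_g_x, smul_smul, ← Finset.sum_smul,
      smul_eq_zero, hgen.x_ne_zero, or_false] at this
    exact this
  -- By `key` every simple root kills this combination of coroots, and the simple roots span the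
  -- dual of `H`.
  have h0 : ∑ i, c i • b.toCoweightBasis i = 0 := by
    rw [← Module.forall_dual_apply_eq_zero_iff ℂ]
    suffices Dual.eval ℂ H (∑ i, c i • b.toCoweightBasis i) = 0 from
      fun f ↦ LinearMap.congr_fun this f
    refine b.toWeightBasis.ext fun j ↦ ?_
    simpa using key j
  exact Fintype.linearIndependent_iff.mp b.toCoweightBasis.linearIndependent c h0

theorem generated_eq_top (hgen : IsCanonicalGeneratingSet b g x y) : generated x y = ⊤ := by
  choose z hz hz₀ hzχ using hgen.isGeneratedWeight_root
  have hind := iSupIndep_jointEigenspace (K := ℂ) (M := L) hgen.lie_g_g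
  have hinj : Function.Injective
      fun (β : H.root) (k : b.support) ↦ (rootSystem H).pairing β k := by
    intro β γ h
    apply (rootSystem H).root.injective
    rw [← sub_eq_zero]
    refine eq_zero_of_apply_coroot_eq_zero (b := b) fun i ↦ ?_
    simpa [sub_eq_zero] using congrFun h i
  have hne : ∀ β : H.root, (fun k : b.support ↦ (rootSystem H).pairing β k) ≠ 0 := by
    intro β h
    apply (rootSystem H).ne_zero β
    exact eq_zero_of_apply_coroot_eq_zero (b := b) fun i ↦ by simpa using congrFun h i
  have hli : LinearIndependent ℂ z := (hind.comp hinj).linearIndependent _ hzχ hz₀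
  -- The `g i` have weight 0, and by `hne` no root gives the weight 0.
  have hdis : Disjoint (Submodule.span ℂ (Set.range z)) (Submodule.span ℂ (Set.range g)) := by
    refine (hind (0 : b.support → ℂ)).symm.mono ?_ ?_
    · rw [Submodule.span_le]
      rintro _ ⟨β, rfl⟩
      exact Submodule.mem_iSup_of_mem _ (Submodule.mem_iSup_of_mem (hne β) (hzχ β))
    · rw [Submodule.span_le]
      rintro _ ⟨i, rfl⟩
      exact mem_jointEigenspace.mpr fun k ↦ by simp [hgen.lie_g_g]
  have hsum := hli.sum_type hgen.linearIndependent_g hdis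
  have hsub : Submodule.span ℂ (Set.range (Sum.elim z g)) ≤ (generated x y).toSubmodule := by
    rw [Submodule.span_le]
    rintro _ ⟨β | i, rfl⟩
    · exact hz β
    · exact hgen.g_mem_generated i
  rw [← LieSubalgebra.toSubmodule_inj, LieSubalgebra.top_toSubmodule]
  refine Submodule.eq_top_of_finrank_eq (le_antisymm (Submodule.finrank_le _) ?_)
  calc finrank ℂ L ≤ _ := finrank_le_card_root_add_card_support (b := b)
    _ = _ := (finrank_span_eq_card hsum).symm
    _ ≤ _ := Submodule.finrank_mono hsub

end IsCanonicalGeneratingSet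

end Generators

theorem word_nil {ι L V : Type*} [LieRing L] [LieAlgebra ℂ L]
    [AddCommGroup V] [Module ℂ V] [LieRingModule L V] [LieModule ℂ L V] (y : ι → L) (v : V) :
    word y v [] = v := rfl

theorem word_cons {ι L V : Type*} [LieRing L] [LieAlgebra ℂ L]
    [AddCommGroup V] [Module ℂ V] [LieRingModule L V] [LieModule ℂ L V] (y : ι → L) (v : V)
    (i : ι) (s : List ι) : word y v (i :: s) = ⁅y i, word y v s⁆ := by
  simp [word]

namespace IsCanonicalGeneratingSet

variable {L : Type*} [LieRing L] [LieAlgebra ℂ L] [FiniteDimensional ℂ L]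
  [LieAlgebra.IsSemisimple ℂ L] {H : LieSubalgebra ℂ L} [H.IsCartanSubalgebra]
  {b : (rootSystem H).Base} {g x y : b.support → L}
  {lam : Dual ℂ (Submodule.span ℂ (Set.range g))}

/-! ### Action of the generators on words -/

section Word

variable {V : Type*} [AddCommGroup V] [Module ℂ V] [LieRingModule L V] [LieModule ℂ L V] {v : V}

/-- The weight of `word y v s` when `v` has weight `lam`. -/
noncomputable def wordWeight (lam : Dual ℂ (Submodule.span ℂ (Set.range g)))
    (s : List b.support) (i : b.support) : ℂ :=
  lam ⟨g i, Submodule.subset_span ⟨i, rfl⟩⟩ - (s.map fun j : b.support ↦ (rootSystem H).pairing j i).sum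

theorem lie_g_word (hgen : IsCanonicalGeneratingSet b g x y)
    (hv : IsHighestWeightVector g x lam v) (s : List b.support) (i : b.support) :
    ⁅g i, word y v s⁆ = wordWeight lam s i • word y v s := by
  induction s with
  | nil => simpa [word_nil, wordWeight] using
      hv.weight ⟨g i, Submodule.subset_span ⟨i, rfl⟩⟩
  | cons j s ih =>
    rw [word_cons, leibniz_lie, hgen.lie_g_y, neg_lie, smul_lie, ih, lie_smul, ← neg_smul,
      ← add_smul]
    congr 1
    simp only [wordWeight, List.map_cons, List.sum_cons]
    ring

open scoped Classical in
theorem lie_x_word_cons (hgen : IsCanonicalGeneratingSet b g x y)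
    (hv : IsHighestWeightVector g x lam v) (i j : b.support) (s : List b.support) :
    ⁅x i, word y v (j :: s)⁆ =
      (if i = j then wordWeight lam s i else 0) • word y v s + ⁅y j, ⁅x i, word y v s⁆⁆ := by
  rw [word_cons, leibniz_lie]
  split_ifs with h
  · subst h
    rw [hgen.lie_x_y_same, hgen.lie_g_word hv]
  · rw [hgen.lie_x_y_ne i j h, zero_lie, zero_smul]

/-- An element of the span of the `g i` on which every simple root takes the value `1`. -/
theorem exists_coeff_pairing_eq_one :
    ∃ c : b.support → ℂ, ∀ j : b.support, ∑ i, c i * (rootSystem H).pairing j i = 1 := by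
  -- The coefficients are found in `H`, where reflexivity turns a functional on the roots into an
  -- element; they are then used with the `g i`.
  let f : Dual ℂ (Dual ℂ H) := b.toWeightBasis.constr ℂ fun _ ↦ (1 : ℂ)
  let u : H := (Module.evalEquiv ℂ H).symm f
  refine ⟨b.toCoweightBasis.repr u, fun j ↦ ?_⟩
  have h1 : (rootSystem H).root j u = 1 := by
    rw [Module.apply_evalEquiv_symm_apply, ← b.toWeightBasis_apply j]
    exact b.toWeightBasis.constr_basis _ _ _
  rw [← b.toCoweightBasis.sum_repr u] at h1
  simpa using h1

/-- A grading by word length: each letter lowers the eigenvalue by 1, which separates the empty word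
from all others. -/
theorem lie_grading_word (hgen : IsCanonicalGeneratingSet b g x y)
    (hv : IsHighestWeightVector g x lam v) {c : b.support → ℂ}
    (hc : ∀ j : b.support, ∑ i, c i * (rootSystem H).pairing j i = 1) (s : List b.support) :
    ⁅∑ i, c i • g i, word y v s⁆ =
      ((∑ i, c i * wordWeight lam [] i) - s.length : ℂ) • word y v s := by
  simp only [sum_lie, smul_lie, hgen.lie_g_word hv, smul_smul, ← Finset.sum_smul]
  congr 1
  induction s with
  | nil => simp
  | cons j s ih =>
    have : ∀ i, c i * wordWeight lam (j :: s) i =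
        c i * wordWeight lam s i - c i * (rootSystem H).pairing j i := by
      intro i
      simp only [wordWeight, List.map_cons, List.sum_cons]
      ring
    rw [Finset.sum_congr rfl fun i _ ↦ this i, Finset.sum_sub_distrib, ih, hc]
    push_cast [List.length_cons]
    ring

end Word

/-! ### The submodule of pairs of words in `V × W` -/

variable {V W : Type*} [AddCommGroup V] [Module ℂ V] [LieRingModule L V] [LieModule ℂ L V]
  [AddCommGroup W] [Module ℂ W] [LieRingModule L W] [LieModule ℂ L W] {v : V} {w : W}

/-- The span in `V × W` of the pairs of words in `v` and `w`. -/
def wordPairSpan (y : b.support → L) (v : V) (w : W) : Submodule ℂ (V × W) :=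
  Submodule.span ℂ (Set.range fun s : List b.support ↦ (word y v s, word y w s))

theorem word_pair_mem (s : List b.support) : (word y v s, word y w s) ∈ wordPairSpan y v w :=
  Submodule.subset_span ⟨s, rfl⟩

/-- The elements of `L` whose diagonal action on `V × W` preserves a given subspace. -/
def diagonalStabilizer (U : Submodule ℂ (V × W)) : LieSubalgebra ℂ L where
  carrier := {z | ∀ u ∈ U, (⁅z, u.1⁆, ⁅z, u.2⁆) ∈ U}
  zero_mem' u _ := by
    rw [zero_lie, zero_lie]
    exact U.zero_mem
  add_mem' {a c} ha hc u hu := by simpa [add_lie] using U.add_mem (ha u hu) (hc u hu)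
  smul_mem' r a ha u hu := by simpa [smul_lie] using U.smul_mem r (ha u hu)
  lie_mem' {a c} ha hc u hu := by
    simpa [lie_lie] using U.sub_mem (ha _ (hc u hu)) (hc _ (ha u hu))

theorem mem_diagonalStabilizer_wordPairSpan {z : L}
    (hz : ∀ s, (⁅z, word y v s⁆, ⁅z, word y w s⁆) ∈ wordPairSpan y v w) :
    z ∈ diagonalStabilizer (wordPairSpan y v w) := by
  intro u hu
  induction hu using Submodule.span_induction with
  | mem _ h => obtain ⟨s, rfl⟩ := h; exact hz s
  | zero =>
    rw [Prod.fst_zero, Prod.snd_zero, lie_zero, lie_zero]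
    exact Submodule.zero_mem _
  | add a c _ _ ha hc => simpa using Submodule.add_mem _ ha hc
  | smul r a _ ha => simpa using Submodule.smul_mem _ r ha

theorem diagonalStabilizer_wordPairSpan (hgen : IsCanonicalGeneratingSet b g x y)
    (hv : IsHighestWeightVector g x lam v) (hw : IsHighestWeightVector g x lam w) :
    diagonalStabilizer (wordPairSpan y v w) = (⊤ : LieSubalgebra ℂ L) := by
  have hy (j : b.support) : y j ∈ diagonalStabilizer (wordPairSpan y v w) :=
    mem_diagonalStabilizer_wordPairSpan fun s ↦ by
      simpa [word_cons] using word_pair_mem (y := y) (v := v) (w := w) (j :: s)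
  rw [eq_top_iff, ← hgen.generated_eq_top, generated, LieSubalgebra.lieSpan_le]
  rintro _ (⟨i, rfl⟩ | ⟨j, rfl⟩)
  · refine mem_diagonalStabilizer_wordPairSpan fun s ↦ ?_
    induction s with
    | nil =>
      have h1 : ⁅x i, v⁆ = 0 := hv.killed i
      have h2 : ⁅x i, w⁆ = 0 := hw.killed i
      rw [word_nil, word_nil, h1, h2]
      exact Submodule.zero_mem _
    | cons j s ih =>
      -- The scalar depends only on `lam`, so it is common to both components.
      rw [hgen.lie_x_word_cons hv, hgen.lie_x_word_cons hw]
      exact Submodule.add_mem _ (Submodule.smul_mem _ _ (word_pair_mem s)) (hy j _ ih)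
  · exact hy j

theorem prod_lie_mem_wordPairSpan (hgen : IsCanonicalGeneratingSet b g x y)
    (hv : IsHighestWeightVector g x lam v) (hw : IsHighestWeightVector g x lam w) (z : L)
    {u : V × W} (hu : u ∈ wordPairSpan y v w) : (⁅z, u.1⁆, ⁅z, u.2⁆) ∈ wordPairSpan y v w := by
  have hz : z ∈ diagonalStabilizer (wordPairSpan y v w) := by
    rw [hgen.diagonalStabilizer_wordPairSpan hv hw]
    trivial
  exact hz u hu

theorem zero_prod_notMem_wordPairSpan (hgen : IsCanonicalGeneratingSet b g x y)
    (hv : IsHighestWeightVector g x lam v) (hw : IsHighestWeightVector g x lam w) :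
    ((0 : V), w) ∉ wordPairSpan y v w := by
  intro hmem
  obtain ⟨c, hc⟩ := exists_coeff_pairing_eq_one (b := b)
  set d : L := ∑ i, c i • g i
  set μ : ℂ := ∑ i, c i * wordWeight lam [] i
  let D : Module.End ℂ (V × W) := (toEnd ℂ L V d).prodMap (toEnd ℂ L W d)
  have hD (s : List b.support) :
      (word y v s, word y w s) ∈ D.eigenspace (μ - s.length) := by
    rw [Module.End.mem_eigenspace_iff]
    exact Prod.ext (hgen.lie_grading_word hv hc s) (hgen.lie_grading_word hw hc s)
  -- Only the empty word has eigenvalue `μ`, so the `μ`-part of the span is the line through `(v,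
  -- w)`, which does not contain `(0, w)`.
  have hle : wordPairSpan y v w ≤
      Submodule.span ℂ {(v, w)} ⊔ ⨆ ν : ℂ, ⨆ _ : ν ≠ μ, D.eigenspace ν := by
    refine Submodule.span_le.mpr ?_
    rintro _ ⟨s, rfl⟩
    rcases s with _ | ⟨j, s⟩
    · exact Submodule.mem_sup_left (Submodule.mem_span_singleton_self _)
    · refine Submodule.mem_sup_right (Submodule.mem_iSup_of_mem _
        (Submodule.mem_iSup_of_mem ?_ (hD (j :: s))))
      simpa [sub_eq_self] using Nat.cast_add_one_ne_zero (R := ℂ) s.length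
  obtain ⟨p, hp, q, hq, hpq⟩ := Submodule.mem_sup.mp (hle hmem)
  obtain ⟨r, rfl⟩ := Submodule.mem_span_singleton.mp hp
  have hvw : (v, w) ∈ D.eigenspace μ := by simpa [word_nil] using hD []
  have h0w : ((0 : V), w) ∈ D.eigenspace μ := by
    have h2 := congrArg Prod.snd (Module.End.mem_eigenspace_iff.mp hvw)
    exact Module.End.mem_eigenspace_iff.mpr (Prod.ext (by simp [D]) h2)
  have hqμ : q ∈ D.eigenspace μ := by
    rw [← eq_sub_iff_add_eq'] at hpq
    exact hpq ▸ Submodule.sub_mem _ h0w (Submodule.smul_mem _ r hvw)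
  have hq0 : q = 0 := Submodule.disjoint_def.mp (D.eigenspaces_iSupIndep μ) q hqμ hq
  rw [hq0, add_zero, Prod.smul_mk, Prod.mk.injEq, smul_eq_zero] at hpq
  have hr : r = 0 := hpq.1.resolve_right hv.ne_zero
  exact hw.ne_zero (by rw [← hpq.2, hr, zero_smul])

theorem eq_zero_of_zero_prod_mem_wordPairSpan (hgen : IsCanonicalGeneratingSet b g x y)
    (hW : LieModule.IsIrreducible ℂ L W)
    (hv : IsHighestWeightVector g x lam v) (hw : IsHighestWeightVector g x lam w)
    {w' : W} (hw' : ((0 : V), w') ∈ wordPairSpan y v w) : w' = 0 := by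
  let N : LieSubmodule ℂ L W :=
    { (wordPairSpan y v w).comap (LinearMap.inr ℂ V W) with
      lie_mem := fun {z m} hm ↦ by
        simpa using hgen.prod_lie_mem_wordPairSpan hv hw z (u := (0, m)) hm }
  have hN : w' ∈ N := hw'
  rcases hW.eq_bot_or_eq_top N with h | h
  · rwa [h, LieSubmodule.mem_bot] at hN
  · have : w ∈ N := h ▸ LieSubmodule.mem_top w
    exact absurd this (hgen.zero_prod_notMem_wordPairSpan hv hw)

theorem prod_wordMap_mem_wordPairSpan {S : Set (List b.support)} (hS : IsWordBasis y v S) (u : V) :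
    (u, wordMap hS w u) ∈ wordPairSpan y v w := by
  have hu := hS.span_eq_top (Submodule.mem_top (x := u))
  induction hu using Submodule.span_induction with
  | mem _ h =>
    obtain ⟨s, rfl⟩ := h
    rw [wordMap_word hS w s.2]
    exact word_pair_mem _
  | zero =>
    rw [map_zero]
    exact Submodule.zero_mem _
  | add a c _ _ ha hc => simpa using Submodule.add_mem _ ha hc
  | smul r a _ ha => simpa using Submodule.smul_mem _ r ha

end IsCanonicalGeneratingSet

end HighestWeight

end

theorem mainTheorem5 {L V W : Type*} [LieRing L] [LieAlgebra ℂ L] [FiniteDimensional ℂ L]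
    [LieAlgebra.IsSemisimple ℂ L]
    (H : LieSubalgebra ℂ L) [H.IsCartanSubalgebra]
    (b : (LieAlgebra.IsKilling.rootSystem H).Base) (g x y : b.support → L)
    (hgen : HighestWeight.IsCanonicalGeneratingSet b g x y)
    [AddCommGroup V] [Module ℂ V] [LieRingModule L V] [LieModule ℂ L V] [FiniteDimensional ℂ V]
    [AddCommGroup W] [Module ℂ W] [LieRingModule L W] [LieModule ℂ L W] [FiniteDimensional ℂ W]
    (hV : LieModule.IsIrreducible ℂ L V) (hW : LieModule.IsIrreducible ℂ L W)
    (lam : Module.Dual ℂ (Submodule.span ℂ (Set.range g))) (v : V) (w : W)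
    (hv : HighestWeight.IsHighestWeightVector g x lam v)
    (hw : HighestWeight.IsHighestWeightVector g x lam w)
    (S : Set (List b.support)) (hS : HighestWeight.IsWordBasis y v S) :
    ∀ z : L, HighestWeight.wordMap hS w ∘ₗ LieModule.toEnd ℂ L V z =
      LieModule.toEnd ℂ L W z ∘ₗ HighestWeight.wordMap hS w := by
  intro z
  refine LinearMap.ext fun u ↦ sub_eq_zero.mp ?_
  refine hgen.eq_zero_of_zero_prod_mem_wordPairSpan hW hv hw ?_
  have h1 := HighestWeight.IsCanonicalGeneratingSet.prod_wordMap_mem_wordPairSpan (w := w) hS ⁅z, u⁆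
  have h2 := hgen.prod_lie_mem_wordPairSpan hv hw z
    (HighestWeight.IsCanonicalGeneratingSet.prod_wordMap_mem_wordPairSpan (w := w) hS u)
  simpa using Submodule.sub_mem _ h1 h2
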